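/- Let $q,a,b,c,d,r$ be complex numbers with $|q|<1$, $c\neq 0$, $r\neq 0$. Write $(x;q)_n=\prod_{k=0}^{n-1}(1-xq^k)$, $(x;q)_\infty=\prod_{k\ge 0}(1-xq^k)$, $(x_1,\dots,x_m;q)_n=\prod_{j=1}^m (x_j;q)_n$ for $n$ a nonnegative integer or $\infty$, $$h(x;a)=\prod_{k=0}^\infty(1-2q^kax+q^{2k}a^2),\qquad h(x;a_1,\dots,a_m)=\prod_{j=1}^m h(x;a_j),$$ so that $h(\cos\theta;a)=(ae^{i\theta},ae^{-i\theta};q)_\infty$, and $${}_3\phi_2\left({\alpha_1,\alpha_2,\alpha_3\atop\beta_1,\beta_2};q,z\right)=\sum_{n=0}^\infty\frac{(\alpha_1,\alpha_2,\alpha_3;q)_n}{(q,\beta_1,\beta_2;q)_n}z^n .$$ If $\max\{|a|,|b|,|c|,|d|,|abr/c|\}<1$, then the ${}_3\phi_2$ series below converges absolutely for every real $\theta$, the integrand is integrable on $[0,\pi]$, and $$\int_0^\pi \frac{h(\cos 2\theta;1)}{h(\cos\theta;a,b,c,d)}\;{}_3\phi_2\left({ce^{i\theta},ce^{-i\theta},c/r\atop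 ac,bc};q,\frac{abr}{c}\right)d\theta=\frac{2\pi\,(abdr;q)_\infty}{(q,ac,ad,bc,bd,cd,abr/c;q)_\infty}.$$ Moreover, the function $$I(x)=\frac{(acdx,abrx;q)_\infty}{(ax,bx,cx,dx;q)_\infty}\;{}_3\phi_2\left({ar,ax,cx\atop acdx,abrx};q,bd\right)$$ has a convergent power series expansion $I(x)=\sum_{k\ge 0}a_kx^k$ near $x=0$, and the integral also equals $$\frac{2\pi a_0}{(q,ac,ad,bc,cd,abr/c;q)_\infty}.$$ -/

import Mathlib

open scoped BigOperators Topology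

/-- The finite `q`-shifted factorial `(a; q)_n = ∏_{k=0}^{n-1} (1 - a q^k)`. -/
noncomputable def qPoch (a q : ℂ) (n : ℕ) : ℂ :=
  ∏ k ∈ Finset.range n, (1 - a * q ^ k)

/-- The infinite `q`-shifted factorial `(a; q)_∞ = ∏_{k=0}^∞ (1 - a q^k)`. -/
noncomputable def qPochInf (a q : ℂ) : ℂ :=
  ∏' k : ℕ, (1 - a * q ^ k)

/-- The multiple symbol `(a_1, …, a_m; q)_n = (a_1; q)_n ⋯ (a_m; q)_n`. -/
noncomputable def qPochs (as : List ℂ) (q : ℂ) (n : ℕ) : ℂ :=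
  (as.map fun a => qPoch a q n).prod

/-- The multiple symbol `(a_1, …, a_m; q)_∞ = (a_1; q)_∞ ⋯ (a_m; q)_∞`. -/
noncomputable def qPochsInf (as : List ℂ) (q : ℂ) : ℂ :=
  (as.map fun a => qPochInf a q).prod

/-- The `n`-th term of the basic hypergeometric series `_rφ_s(as; bs; q, z)`. -/
noncomputable def basicHypergeomTerm (as bs : List ℂ) (q z : ℂ) (n : ℕ) : ℂ :=
  qPochs as q n / qPochs (q :: bs) q n *
    ((-1) ^ n * q ^ (n * (n - 1) / 2)) ^ (1 + (bs.length : ℤ) - (as.length : ℤ)) * z ^ n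

/-- The basic hypergeometric series `_rφ_s(as; bs; q, z)`. -/
noncomputable def basicHypergeom (as bs : List ℂ) (q z : ℂ) : ℂ :=
  ∑' n : ℕ, basicHypergeomTerm as bs q z n

/-- `h(x; a) = ∏_{k=0}^∞ (1 - 2 q^k a x + q^{2k} a^2)`. -/
noncomputable def hProd (q x a : ℂ) : ℂ :=
  ∏' k : ℕ, (1 - 2 * q ^ k * a * x + q ^ (2 * k) * a ^ 2)

/-- `h(x; a_1, …, a_m) = h(x; a_1) ⋯ h(x; a_m)`. -/
noncomputable def hProds (q x : ℂ) (as : List ℂ) : ℂ :=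
  (as.map fun a => hProd q x a).prod

/-- The infinite products `(a; q)_∞` converge for `|q| < 1`. -/
theorem multipliable_qPochInf (a : ℂ) {q : ℂ} (hq : ‖q‖ < 1) :
    Multipliable fun k : ℕ => 1 - a * q ^ k := by
  have h : Summable fun k : ℕ => ‖-(a * q ^ k)‖ := by
    simpa [norm_mul, norm_pow] using
      (summable_geometric_of_lt_one (norm_nonneg q) hq).mul_left ‖a‖
  simpa [sub_eq_add_neg] using multipliable_one_add_of_summable h

/-- The two descriptions of `h` agree: `h(cos θ; a) = (a e^{iθ}, a e^{-iθ}; q)_∞`. -/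
theorem hProd_cos (a θ : ℂ) {q : ℂ} (hq : ‖q‖ < 1) :
    hProd q (Complex.cos θ) a =
      qPochsInf [a * Complex.exp (Complex.I * θ), a * Complex.exp (-(Complex.I * θ))] q := by
  have he : Complex.exp (Complex.I * θ) * Complex.exp (-(Complex.I * θ)) = 1 := by
    rw [← Complex.exp_add]; simp
  have hc : 2 * Complex.cos θ =
      Complex.exp (Complex.I * θ) + Complex.exp (-(Complex.I * θ)) := by
    rw [Complex.two_cos]; ring_nf
  simp only [hProd, qPochsInf, qPochInf, List.map_cons, List.map_nil, List.prod_cons,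
    List.prod_nil, mul_one]
  rw [← (multipliable_qPochInf _ hq).tprod_mul (multipliable_qPochInf _ hq)]
  refine tprod_congr fun k => ?_
  linear_combination (-(q ^ k * a)) * hc - (q ^ (2 * k) * a ^ 2) * he

/-- The function
`I(x) = (acdx, abrx; q)_∞ / (ax, bx, cx, dx; q)_∞ * _3φ_2(ar, ax, cx; acdx, abrx; q, bd)`. -/
noncomputable def liuI (q a b c d r x : ℂ) : ℂ :=
  qPochsInf [a * c * d * x, a * b * r * x] q / qPochsInf [a * x, b * x, c * x, d * x] q *
    basicHypergeom [a * r, a * x, c * x] [a * c * d * x, a * b * r * x] q (b * d)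

/-- The integrand of the beta integral, as a function of the angle `θ`. -/
noncomputable def betaIntegrand (q a b c d r : ℂ) (θ : ℝ) : ℂ :=
  hProds q (Complex.cos (2 * θ)) [1] / hProds q (Complex.cos θ) [a, b, c, d] *
    basicHypergeom
      [c * Complex.exp (Complex.I * θ), c * Complex.exp (-(Complex.I * θ)), c / r]
      [a * c, b * c] q (a * b * r / c)

/-! ### Finite and infinite `q`-shifted factorials: recursions, zeros, bounds. -/

open Filter

/-! Put `z = e^{iθ}`. The quotient of `h`'s is the Askey–Wilson weight `W(a,b,c,d; z)`, and the
factor `(cz, c/z; q)_n` of the `n`-th term of the `₃φ₂` merely replaces `c` by `c q^n` in that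
weight. Integrating term by term, each integral is an Askey–Wilson integral
(`askeyWilsonAverage_eq`). In its value the factors `(ac, bc; q)_n` cancel the lower parameters of
the `₃φ₂`, leaving `₂φ₁(c/r, cd; abcd; q, abr/c)`, whose argument is exactly the one summed by
`q`-Gauss (`tsum_qGaussTerm`).

Both ingredients are proved by iterating a contiguous relation to a trivial limit. For `q`-Gauss,
`z` becomes `zq`, and the relation holds because the terms telescope. For Askey–Wilson, `a` becomes
`aq`. Here a contour shift from `|z| = 1` to `|z| = |q|` (`circleAverage_askeyWilsonAux`) gives the
needed linear relation between the averages of `W` and `W·(z + 1/z)`. All four parameters are thus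
sent to `0`, and the remaining constant is found from the parameters `±√q, ±q`, where the weight is
a Laurent polynomial.

For the last claim, `a_0 = I(0)`. At `x = 0` the series is a `₁φ₀`, so the `q`-binomial theorem
gives `I(0) = (abdr; q)_∞ / (bd; q)_∞`. -/

@[simp]
theorem qPoch_zero_right (a q : ℂ) : qPoch a q 0 = 1 := by simp [qPoch]

theorem qPoch_succ (a q : ℂ) (n : ℕ) : qPoch a q (n + 1) = qPoch a q n * (1 - a * q ^ n) :=
  Finset.prod_range_succ _ _

theorem qPoch_succ' (a q : ℂ) (n : ℕ) : qPoch a q (n + 1) = (1 - a) * qPoch (a * q) q n := by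
  rw [qPoch, Finset.prod_range_succ', pow_zero, mul_one, mul_comm]
  simp only [qPoch, pow_succ', mul_assoc]

@[simp]
theorem qPoch_zero_left (q : ℂ) (n : ℕ) : qPoch 0 q n = 1 := by simp [qPoch]

@[simp]
theorem qPochInf_zero_left (q : ℂ) : qPochInf 0 q = 1 := by simp [qPochInf]

theorem qPochInf_eq_mul (a : ℂ) {q : ℂ} (hq : ‖q‖ < 1) (n : ℕ) :
    qPochInf a q = qPoch a q n * qPochInf (a * q ^ n) q := by
  have h : (fun k : ℕ => 1 - a * q ^ (k + n)) = fun k => 1 - a * q ^ n * q ^ k := by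
    funext k; ring
  have hm : Multipliable fun k : ℕ => 1 - a * q ^ (k + n) := by
    rw [h]; exact multipliable_qPochInf _ hq
  have := hm.prod_mul_tprod_nat_mul' (f := fun k : ℕ => 1 - a * q ^ k)
  rw [h] at this
  exact this.symm

theorem qPochInf_step (a : ℂ) {q : ℂ} (hq : ‖q‖ < 1) :
    qPochInf a q = (1 - a) * qPochInf (a * q) q := by
  simpa [qPoch] using qPochInf_eq_mul a hq 1

theorem norm_mul_pow_lt_one {a q : ℂ} (hq : ‖q‖ < 1) (ha : ‖a‖ < 1) (n : ℕ) :
    ‖a * q ^ n‖ < 1 := by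
  rw [norm_mul, norm_pow]
  exact mul_lt_one_of_nonneg_of_lt_one_left (norm_nonneg _) ha
    (pow_le_one₀ (norm_nonneg _) hq.le)

theorem norm_mul_lt_one {a b : ℂ} (ha : ‖a‖ < 1) (hb : ‖b‖ < 1) : ‖a * b‖ < 1 := by
  rw [norm_mul]
  exact mul_lt_one_of_nonneg_of_lt_one_left (norm_nonneg _) ha hb.le

theorem one_sub_ne_zero_of_norm_lt_one {a : ℂ} (ha : ‖a‖ < 1) : 1 - a ≠ 0 := by
  intro h
  rw [← sub_eq_zero.1 h] at ha
  simp at ha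

theorem qPoch_ne_zero {a q : ℂ} (hq : ‖q‖ < 1) (ha : ‖a‖ < 1) (n : ℕ) : qPoch a q n ≠ 0 :=
  Finset.prod_ne_zero_iff.2 fun k _ => one_sub_ne_zero_of_norm_lt_one (norm_mul_pow_lt_one hq ha k)

theorem qPochInf_ne_zero {a q : ℂ} (hq : ‖q‖ < 1) (ha : ‖a‖ < 1) : qPochInf a q ≠ 0 := by
  have h : Summable fun k : ℕ => ‖-(a * q ^ k)‖ := by
    simpa [norm_mul, norm_pow] using
      (summable_geometric_of_lt_one (norm_nonneg q) hq).mul_left ‖a‖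
  have := tprod_one_add_ne_zero_of_summable (f := fun k : ℕ => -(a * q ^ k))
    (fun k => by
      rw [← sub_eq_add_neg]
      exact one_sub_ne_zero_of_norm_lt_one (norm_mul_pow_lt_one hq ha k)) h
  simpa [qPochInf, sub_eq_add_neg] using this

theorem differentiable_qPoch (q : ℂ) (n : ℕ) : Differentiable ℂ fun a => qPoch a q n := by
  unfold qPoch
  fun_prop

theorem differentiable_qPochInf {q : ℂ} (hq : ‖q‖ < 1) :
    Differentiable ℂ fun a => qPochInf a q := by
  intro a
  have hu : Summable fun k : ℕ => (‖a‖ + 1) * ‖q‖ ^ k :=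
    (summable_geometric_of_lt_one (norm_nonneg q) hq).mul_left _
  have h := Summable.hasProdLocallyUniformlyOn_nat_one_add
    (f := fun (k : ℕ) (x : ℂ) => -(x * q ^ k)) (K := Metric.ball 0 (‖a‖ + 1))
    Metric.isOpen_ball hu
    (.of_forall fun k x hx => by
      rw [norm_neg, norm_mul, norm_pow]
      gcongr
      exact (mem_ball_zero_iff.1 hx).le)
    (fun k => by fun_prop)
  have hd := h.differentiableOn
    (.of_forall fun s => by
      simpa [Finset.prod_fn] using DifferentiableOn.finsetProd (fun _ _ ↦ by fun_prop))
    Metric.isOpen_ball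
  have := hd.differentiableAt (Metric.isOpen_ball.mem_nhds
    (mem_ball_zero_iff.2 (lt_add_one ‖a‖)))
  simpa [qPochInf, sub_eq_add_neg] using this

theorem continuous_qPochInf {q : ℂ} (hq : ‖q‖ < 1) : Continuous fun a => qPochInf a q :=
  (differentiable_qPochInf hq).continuous

theorem sum_norm_mul_pow_le {q : ℂ} (hq : ‖q‖ < 1) {ρ : ℝ} (hρ : 0 ≤ ρ) (n : ℕ) :
    ∑ k ∈ Finset.range n, ρ * ‖q‖ ^ k ≤ ρ / (1 - ‖q‖) := by
  rw [← Finset.mul_sum, div_eq_mul_inv, ← tsum_geometric_of_lt_one (norm_nonneg q) hq]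
  gcongr
  exact (summable_geometric_of_lt_one (norm_nonneg q) hq).sum_le_tsum _
    fun _ _ => by positivity

/-- Each factor is at most `1 + ρ|q|^k ≤ exp(ρ|q|^k)`. The bound is uniform in `n`; together with
the next one it dominates every hypergeometric series below by a geometric one. -/
theorem norm_qPoch_le {a q : ℂ} (hq : ‖q‖ < 1) {ρ : ℝ} (ha : ‖a‖ ≤ ρ) (n : ℕ) :
    ‖qPoch a q n‖ ≤ Real.exp (ρ / (1 - ‖q‖)) := by
  have hρ : 0 ≤ ρ := (norm_nonneg a).trans ha
  refine le_trans ?_ (Real.exp_le_exp.2 (sum_norm_mul_pow_le hq hρ n))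
  rw [qPoch, norm_prod, Real.exp_sum]
  refine Finset.prod_le_prod (fun _ _ => norm_nonneg _) fun k _ => ?_
  calc ‖1 - a * q ^ k‖ ≤ 1 + ‖a‖ * ‖q‖ ^ k := by
        simpa [norm_mul, norm_pow] using norm_sub_le (1 : ℂ) (a * q ^ k)
    _ ≤ ρ * ‖q‖ ^ k + 1 := by rw [add_comm]; gcongr
    _ ≤ _ := Real.add_one_le_exp _

/-- With `t = ρ|q|^k ≤ ρ`, use `1/(1 - t) = 1 + t/(1 - t) ≤ exp(t/(1 - ρ))`. -/
theorem norm_qPoch_inv_le {a q : ℂ} (hq : ‖q‖ < 1) {ρ : ℝ} (ha : ‖a‖ ≤ ρ) (hρ1 : ρ < 1)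
    (n : ℕ) : ‖(qPoch a q n)⁻¹‖ ≤ Real.exp (ρ / (1 - ρ) / (1 - ‖q‖)) := by
  have hρ : 0 ≤ ρ := (norm_nonneg a).trans ha
  have h1 : 0 < 1 - ρ := by linarith
  refine le_trans ?_ (Real.exp_le_exp.2 (sum_norm_mul_pow_le hq (div_nonneg hρ h1.le) n))
  rw [qPoch, norm_inv, norm_prod, Real.exp_sum, ← Finset.prod_inv_distrib]
  refine Finset.prod_le_prod (fun _ _ => by positivity) fun k _ => ?_
  have hk : ‖q‖ ^ k ≤ 1 := pow_le_one₀ (norm_nonneg _) hq.le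
  have hk0 : 0 ≤ ‖q‖ ^ k := by positivity
  have ht : ‖a * q ^ k‖ ≤ ρ * ‖q‖ ^ k := by rw [norm_mul, norm_pow]; gcongr
  have hlow : 1 - ρ * ‖q‖ ^ k ≤ ‖1 - a * q ^ k‖ := by
    have := norm_sub_norm_le (1 : ℂ) (a * q ^ k)
    rw [norm_one] at this
    linarith
  have hρk : ρ * ‖q‖ ^ k ≤ ρ := mul_le_of_le_one_right hρ hk
  have hpos : 0 < 1 - ρ * ‖q‖ ^ k := by linarith
  calc ‖1 - a * q ^ k‖⁻¹ ≤ (1 - ρ * ‖q‖ ^ k)⁻¹ := by gcongr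
    _ = ρ * ‖q‖ ^ k / (1 - ρ * ‖q‖ ^ k) + 1 := by field_simp; ring
    _ ≤ ρ * ‖q‖ ^ k / (1 - ρ) + 1 := by gcongr
    _ = ρ / (1 - ρ) * ‖q‖ ^ k + 1 := by ring
    _ ≤ _ := Real.add_one_le_exp _

theorem tendsto_qPoch (a : ℂ) {q : ℂ} (hq : ‖q‖ < 1) :
    Tendsto (fun n => qPoch a q n) atTop (𝓝 (qPochInf a q)) :=
  (multipliable_qPochInf a hq).hasProd.tendsto_prod_nat

/-! ### The `q`-Gauss sum. -/

/-- The `n`-th term of the series `₂φ₁(A, B; ABz; q, z)`. -/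
noncomputable def qGaussTerm (q A B z : ℂ) (n : ℕ) : ℂ :=
  qPoch A q n * qPoch B q n * (qPoch q q n)⁻¹ * (qPoch (A * B * z) q n)⁻¹ * z ^ n

/-- Uniformity in `N` is what permits dominated convergence as `z q^N → 0`. -/
theorem exists_norm_qGaussTerm_le {q A B z : ℂ} (hq : ‖q‖ < 1) (hC : ‖A * B * z‖ < 1) :
    ∃ K, ∀ N n, ‖qGaussTerm q A B (z * q ^ N) n‖ ≤ K * ‖z‖ ^ n := by
  refine ⟨Real.exp (‖A‖ / (1 - ‖q‖)) * Real.exp (‖B‖ / (1 - ‖q‖)) *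
    Real.exp (‖q‖ / (1 - ‖q‖) / (1 - ‖q‖)) *
    Real.exp (‖A * B * z‖ / (1 - ‖A * B * z‖) / (1 - ‖q‖)), fun N n => ?_⟩
  have hle : ∀ x : ℂ, ‖x * q ^ N‖ ≤ ‖x‖ := fun x => by
    rw [norm_mul, norm_pow]
    exact mul_le_of_le_one_right (norm_nonneg _) (pow_le_one₀ (norm_nonneg _) hq.le)
  rw [qGaussTerm, norm_mul, norm_mul, norm_mul, norm_mul, norm_pow]
  gcongr
  · exact norm_qPoch_le hq le_rfl n
  · exact norm_qPoch_le hq le_rfl n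
  · exact norm_qPoch_inv_le hq le_rfl hq n
  · refine norm_qPoch_inv_le hq ?_ hC n
    rw [← mul_assoc]
    exact hle _
  · exact hle z

theorem summable_qGaussTerm {q A B z : ℂ} (hq : ‖q‖ < 1) (hz : ‖z‖ < 1)
    (hC : ‖A * B * z‖ < 1) : Summable (qGaussTerm q A B z) := by
  obtain ⟨K, hK⟩ := exists_norm_qGaussTerm_le hq hC
  refine .of_norm_bounded ((summable_geometric_of_lt_one (norm_nonneg z) hz).mul_left K)
    fun n => ?_
  simpa using hK 0 n

/-- Termwise certificate for the relation between the sums at `z` and `zq`: the right side is a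
difference of consecutive values of `(1 - q^n) t_n`, which vanishes at `n = 0` and tends to `0`. -/
theorem qGaussTerm_telescope {q A B z : ℂ} (hq : ‖q‖ < 1) (hC : ‖A * B * z‖ < 1) (n : ℕ) :
    qGaussTerm q A B z n * ((1 - A * B * z) * (1 - z)) -
      (1 - A * z) * (1 - B * z) * qGaussTerm q A B (z * q) n =
    (1 - A * B * z) * ((1 - q ^ n) * qGaussTerm q A B z n -
      (1 - q ^ (n + 1)) * qGaussTerm q A B z (n + 1)) := by
  have hCn : 1 - A * B * z * q ^ n ≠ 0 :=
    one_sub_ne_zero_of_norm_lt_one (norm_mul_pow_lt_one hq hC n)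
  have hC0 : 1 - A * B * z ≠ 0 := one_sub_ne_zero_of_norm_lt_one hC
  have hqn : 1 - q * q ^ n ≠ 0 :=
    one_sub_ne_zero_of_norm_lt_one (norm_mul_pow_lt_one hq hq n)
  have hP := qPoch_ne_zero hq hC n
  have hQ := qPoch_ne_zero hq hq n
  -- The lower parameter `C = ABz` moves with `z`: `(Cq; q)_n = (C; q)_n (1 - C q^n) / (1 - C)`.
  have hs : (qPoch (A * B * (z * q)) q n)⁻¹ =
      (qPoch (A * B * z) q n)⁻¹ * ((1 - A * B * z) / (1 - A * B * z * q ^ n)) := by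
    have h1 := qPoch_succ' (A * B * z) q n
    rw [qPoch_succ, mul_assoc (A * B) z q] at h1
    have h2 : qPoch (A * B * (z * q)) q n =
        qPoch (A * B * z) q n * (1 - A * B * z * q ^ n) / (1 - A * B * z) := by
      rw [h1]; field_simp
    rw [h2]
    field_simp
  simp only [qGaussTerm, hs, qPoch_succ, mul_pow]
  rw [pow_succ q n, pow_succ z n]
  rw [mul_comm q] at hqn ⊢
  generalize q ^ n = x at *
  field_simp
  ring

theorem tsum_qGaussTerm_step {q A B z : ℂ} (hq : ‖q‖ < 1) (hz : ‖z‖ < 1)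
    (hC : ‖A * B * z‖ < 1) :
    (∑' n, qGaussTerm q A B z n) * ((1 - A * B * z) * (1 - z)) =
      (1 - A * z) * (1 - B * z) * ∑' n, qGaussTerm q A B (z * q) n := by
  have hzq : ‖z * q‖ < 1 := norm_mul_lt_one hz hq
  have hCq : ‖A * B * (z * q)‖ < 1 := by
    rw [← mul_assoc]; exact norm_mul_lt_one hC hq
  have hs := summable_qGaussTerm hq hz hC
  have hs' := summable_qGaussTerm hq hzq hCq
  have h1 := (hs.hasSum.mul_right ((1 - A * B * z) * (1 - z))).sub
    (hs'.hasSum.mul_left ((1 - A * z) * (1 - B * z)))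
  simp only [qGaussTerm_telescope hq hC] at h1
  have h2 := h1.tendsto_sum_nat
  simp only [← Finset.mul_sum, Finset.sum_range_sub'] at h2
  have h0 : Tendsto (fun n => (1 - q ^ n) * qGaussTerm q A B z n) atTop (𝓝 ((1 - 0) * 0)) :=
    (tendsto_const_nhds.sub (tendsto_pow_atTop_nhds_zero_of_norm_lt_one hq)).mul
      hs.tendsto_atTop_zero
  have h3 := (tendsto_const_nhds (x := (1 - q ^ 0) * qGaussTerm q A B z 0)).sub h0
    |>.const_mul (1 - A * B * z)
  have h4 := tendsto_nhds_unique h2 h3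
  simp only [pow_zero, sub_self, zero_mul, mul_zero] at h4
  exact sub_eq_zero.1 h4

/-- The `q`-Gauss sum. -/
theorem tsum_qGaussTerm {q A B z : ℂ} (hq : ‖q‖ < 1) (hz : ‖z‖ < 1) (hC : ‖A * B * z‖ < 1) :
    ∑' n, qGaussTerm q A B z n =
      qPochInf (A * z) q * qPochInf (B * z) q / (qPochInf (A * B * z) q * qPochInf z q) := by
  obtain ⟨K, hK⟩ := exists_norm_qGaussTerm_le hq hC
  have hpow : Tendsto (fun N : ℕ => q ^ N) atTop (𝓝 0) :=
    tendsto_pow_atTop_nhds_zero_of_norm_lt_one hq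
  have hsum : Tendsto (fun N : ℕ => ∑' n, qGaussTerm q A B (z * q ^ N) n) atTop (𝓝 1) := by
    have h1 : (1 : ℂ) = ∑' n : ℕ, qGaussTerm q A B 0 n := by
      rw [tsum_eq_single 0 (fun n hn => by simp [qGaussTerm, hn])]
      simp [qGaussTerm]
    rw [h1]
    refine tendsto_tsum_of_dominated_convergence
      ((summable_geometric_of_lt_one (norm_nonneg z) hz).mul_left K) (fun n => ?_)
      (.of_forall hK)
    have hc : ContinuousAt (fun w => qGaussTerm q A B w n) 0 := by
      unfold qGaussTerm
      have hd := (differentiable_qPoch q n).continuous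
      have hi : ContinuousAt (fun w => (qPoch (A * B * w) q n)⁻¹) 0 :=
        ContinuousAt.inv₀ (by fun_prop) (by simp)
      fun_prop
    have := hc.tendsto.comp (by simpa using hpow.const_mul z)
    exact this
  have hinv (N : ℕ) : (∑' n, qGaussTerm q A B z n) * (qPoch (A * B * z) q N * qPoch z q N) =
      qPoch (A * z) q N * qPoch (B * z) q N * ∑' n, qGaussTerm q A B (z * q ^ N) n := by
    induction N with
    | zero => simp
    | succ N ih =>
      have hCN : ‖A * B * (z * q ^ N)‖ < 1 := by
        rw [← mul_assoc]; exact norm_mul_pow_lt_one hq hC N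
      have hst := tsum_qGaussTerm_step hq (norm_mul_pow_lt_one hq hz N) hCN
      rw [mul_assoc z, ← pow_succ] at hst
      simp only [qPoch_succ]
      linear_combination (1 - A * B * z * q ^ N) * (1 - z * q ^ N) * ih +
        qPoch (A * z) q N * qPoch (B * z) q N * hst
  have hl := ((tendsto_qPoch (A * B * z) hq).mul (tendsto_qPoch z hq)).const_mul
    (∑' n, qGaussTerm q A B z n)
  have hr := ((tendsto_qPoch (A * z) hq).mul (tendsto_qPoch (B * z) hq)).mul hsum
  rw [eq_div_iff (mul_ne_zero (qPochInf_ne_zero hq hC) (qPochInf_ne_zero hq hz)),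
    tendsto_nhds_unique hl (hr.congr fun N => (hinv N).symm), mul_one]

/-! ### The Askey–Wilson weight and the contour shift. -/

/-- Multiplication by `w` scales and rotates the circle, and an average ignores the starting angle.
This handles complex `q` in the shift `z ↦ qz`. -/
theorem Real.circleAverage_norm_radius {f : ℂ → ℂ} (w : ℂ) :
    Real.circleAverage f 0 ‖w‖ = Real.circleAverage (fun z => f (w * z)) 0 1 := by
  rw [Real.circleAverage_eq_integral_add w.arg, Real.circleAverage_def]
  congr 2 with θ
  conv_rhs => rw [← Complex.norm_mul_exp_arg_mul_I w]
  congr 1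
  simp only [circleMap, Complex.ofReal_add, add_mul, Complex.exp_add]
  push_cast
  ring

/-- `(az, a/z; q)_∞`. -/
noncomputable def qPochSym (q a z : ℂ) : ℂ :=
  qPochInf (a * z) q * qPochInf (a * z⁻¹) q

/-- The Askey–Wilson weight as a function of `z = e^{iθ}`. -/
noncomputable def askeyWilsonWeight (q a b c d z : ℂ) : ℂ :=
  qPochInf (z ^ 2) q * qPochInf (z⁻¹ ^ 2) q /
    (qPochSym q a z * qPochSym q b z * qPochSym q c z * qPochSym q d z)

theorem qPochSym_ne_zero {q a z : ℂ} (hq : ‖q‖ < 1) (ha : ‖a‖ < 1) (hz : ‖z‖ = 1) :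
    qPochSym q a z ≠ 0 :=
  mul_ne_zero (qPochInf_ne_zero hq (by simpa [hz])) (qPochInf_ne_zero hq (by simpa [hz]))

theorem qPochSym_inv (q a z : ℂ) : qPochSym q a z⁻¹ = qPochSym q a z := by
  rw [qPochSym, qPochSym, inv_inv, mul_comm]

theorem askeyWilsonWeight_inv (q a b c d z : ℂ) :
    askeyWilsonWeight q a b c d z⁻¹ = askeyWilsonWeight q a b c d z := by
  simp only [askeyWilsonWeight, qPochSym_inv, inv_inv]
  rw [mul_comm (qPochInf (z⁻¹ ^ 2) q)]

theorem continuousOn_askeyWilsonWeight {q a b c d : ℂ} (hq : ‖q‖ < 1) (ha : ‖a‖ < 1)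
    (hb : ‖b‖ < 1) (hc : ‖c‖ < 1) (hd : ‖d‖ < 1) :
    ContinuousOn (askeyWilsonWeight q a b c d) (Metric.sphere 0 1) := by
  have hinv : ContinuousOn (fun z : ℂ => z⁻¹) (Metric.sphere 0 1) :=
    continuousOn_inv₀.mono fun z hz => by
      rintro rfl
      simp at hz
  have hP := continuous_qPochInf hq
  unfold askeyWilsonWeight qPochSym
  refine ContinuousOn.div ?_ ?_ fun z hz => ?_
  · exact (hP.comp_continuousOn (by fun_prop)).mul (hP.comp_continuousOn (by fun_prop))
  · have h (x : ℂ) : ContinuousOn (fun z => qPochInf (x * z) q * qPochInf (x * z⁻¹) q)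
        (Metric.sphere 0 1) :=
      (hP.comp_continuousOn (by fun_prop)).mul (hP.comp_continuousOn (by fun_prop))
    exact (((h a).mul (h b)).mul (h c)).mul (h d)
  · have hz : ‖z‖ = 1 := by simpa using hz
    exact mul_ne_zero (mul_ne_zero (mul_ne_zero (qPochSym_ne_zero hq ha hz)
      (qPochSym_ne_zero hq hb hz)) (qPochSym_ne_zero hq hc hz)) (qPochSym_ne_zero hq hd hz)

/-- The function whose contour shift yields the contiguous relation of the Askey–Wilson
integral. -/
noncomputable def askeyWilsonAux (q a b c d z : ℂ) : ℂ :=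
  z * qPochInf (z ^ 2) q * qPochInf (q * z⁻¹ ^ 2) q /
    (qPochInf (a * z) q * qPochInf (a * q * z⁻¹) q *
      (qPochInf (b * z) q * qPochInf (b * q * z⁻¹) q) *
      (qPochInf (c * z) q * qPochInf (c * q * z⁻¹) q) *
      (qPochInf (d * z) q * qPochInf (d * q * z⁻¹) q))

/-- The denominator takes the same value at `qz` and `z⁻¹`; the sign comes from `qz(1 - 1/(qz²)) =
-z⁻¹(1 - qz²)`. -/
theorem askeyWilsonAux_shift {q : ℂ} (hq : ‖q‖ < 1) (hq0 : q ≠ 0) (a b c d : ℂ) {z : ℂ}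
    (hz : z ≠ 0) : askeyWilsonAux q a b c d (q * z) = -askeyWilsonAux q a b c d z⁻¹ := by
  have hden (x : ℂ) : qPochInf (x * (q * z)) q * qPochInf (x * q * (q * z)⁻¹) q =
      qPochInf (x * z⁻¹) q * qPochInf (x * q * z⁻¹⁻¹) q := by
    rw [inv_inv, mul_comm]
    congr 2
    · field_simp
    · ring
  have h1 : qPochInf (q * (q * z)⁻¹ ^ 2) q =
      (1 - q * (q * z)⁻¹ ^ 2) * qPochInf (z⁻¹ ^ 2) q := by
    rw [qPochInf_step _ hq]
    congr 2
    field_simp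
  have h2 : qPochInf (q * z⁻¹⁻¹ ^ 2) q =
      (1 - q * z ^ 2) * qPochInf ((q * z) ^ 2) q := by
    rw [qPochInf_step _ hq, inv_inv]
    congr 2
    ring
  simp only [askeyWilsonAux, hden, h1, h2]
  rw [← neg_div]
  congr 1
  field_simp
  ring

/-- The poles `z = 1/(a q^k)` lie outside the unit circle and the poles `z = a q^(k+1)` inside `|z|
= |q|`, so the closed annulus is free of them. -/
theorem differentiableAt_askeyWilsonAux {q a b c d : ℂ} (hq : ‖q‖ < 1) (ha : ‖a‖ < 1)
    (hb : ‖b‖ < 1) (hc : ‖c‖ < 1) (hd : ‖d‖ < 1) {z : ℂ} (hz0 : z ≠ 0) (hz1 : ‖z‖ ≤ 1)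
    (hz2 : ‖q‖ ≤ ‖z‖) : DifferentiableAt ℂ (askeyWilsonAux q a b c d) z := by
  have hP := differentiable_qPochInf hq
  have hne (x : ℂ) (hx : ‖x‖ < 1) : qPochInf (x * z) q * qPochInf (x * q * z⁻¹) q ≠ 0 := by
    refine mul_ne_zero (qPochInf_ne_zero hq ?_) (qPochInf_ne_zero hq ?_)
    · rw [norm_mul]
      exact mul_lt_one_of_nonneg_of_lt_one_left (norm_nonneg _) hx hz1
    · rw [mul_assoc, norm_mul]
      refine mul_lt_one_of_nonneg_of_lt_one_left (norm_nonneg _) hx ?_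
      rw [norm_mul, norm_inv]
      exact mul_inv_le_one_of_le₀ hz2 (norm_nonneg _)
  have hinv : DifferentiableAt ℂ (fun z : ℂ => z⁻¹) z := differentiableAt_inv hz0
  have hdiff (f : ℂ → ℂ) (hf : DifferentiableAt ℂ f z) :
      DifferentiableAt ℂ (fun z => qPochInf (f z) q) z :=
    (hP (f z)).comp z hf
  have hden (x : ℂ) : DifferentiableAt ℂ
      (fun z => qPochInf (x * z) q * qPochInf (x * q * z⁻¹) q) z :=
    (hdiff _ (by fun_prop)).mul (hdiff _ (by fun_prop))
  unfold askeyWilsonAux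
  refine DifferentiableAt.div ?_ ((((hden a).mul (hden b)).mul (hden c)).mul (hden d))
    (mul_ne_zero (mul_ne_zero (mul_ne_zero (hne a ha) (hne b hb)) (hne c hc)) (hne d hd))
  exact (differentiableAt_id.mul (hdiff _ (by fun_prop))).mul (hdiff _ (by fun_prop))

/-- By Cauchy the averages over `|z| = 1` and `|z| = |q|` agree; by the shift relation and
invariance under `z ↦ z⁻¹` the second is minus the first. -/
theorem circleAverage_askeyWilsonAux {q a b c d : ℂ} (hq : ‖q‖ < 1) (ha : ‖a‖ < 1)
    (hb : ‖b‖ < 1) (hc : ‖c‖ < 1) (hd : ‖d‖ < 1) :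
    Real.circleAverage (askeyWilsonAux q a b c d) 0 1 = 0 := by
  -- For `q = 0` there is no annulus, but the function is holomorphic on the disc and vanishes at
  -- the centre because of its factor `z`.
  rcases eq_or_ne q 0 with rfl | hq0
  · have hP := differentiable_qPochInf hq
    have hd' (x : ℂ) (hx : ‖x‖ < 1) (z : ℂ) (hz : ‖z‖ ≤ 1) : qPochInf (x * z) 0 ≠ 0 := by
      refine qPochInf_ne_zero hq ?_
      rw [norm_mul]
      exact mul_lt_one_of_nonneg_of_lt_one_left (norm_nonneg _) hx hz
    have hcomp (f : ℂ → ℂ) (hf : Differentiable ℂ f) :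
        Differentiable ℂ (fun z => qPochInf (f z) 0) := hP.comp hf
    have hdiff (z : ℂ) (hz : ‖z‖ ≤ 1) :
        DifferentiableAt ℂ (askeyWilsonAux 0 a b c d) z := by
      unfold askeyWilsonAux
      simp only [zero_mul, mul_zero, qPochInf_zero_left, mul_one]
      refine DifferentiableAt.div ?_ ?_ ?_
      · exact (differentiable_id.mul (hcomp _ (by fun_prop))) z
      · exact (((hcomp _ (by fun_prop)).mul (hcomp _ (by fun_prop))).mul
          (hcomp _ (by fun_prop))).mul (hcomp _ (by fun_prop)) z
      · exact mul_ne_zero (mul_ne_zero (mul_ne_zero (hd' a ha z hz) (hd' b hb z hz))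
          (hd' c hc z hz)) (hd' d hd z hz)
    rw [circleAverage_of_differentiable_on_off_countable Set.countable_empty
      (fun z hz => (hdiff z (by simpa using hz)).continuousAt.continuousWithinAt)
      (fun z hz => hdiff z (by simpa using (Metric.mem_ball.1 hz.1).le))]
    simp [askeyWilsonAux]
  · have hq' : 0 < ‖q‖ := norm_pos_iff.2 hq0
    have hdiff (z : ℂ) (h1 : ‖z‖ ≤ 1) (h2 : ‖q‖ ≤ ‖z‖) :=
      differentiableAt_askeyWilsonAux hq ha hb hc hd (norm_pos_iff.1 (hq'.trans_le h2)) h1 h2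
    have h := Complex.circleIntegral_sub_center_inv_smul_eq_of_differentiable_on_annulus_off_countable
      (c := 0) hq' hq.le (f := askeyWilsonAux q a b c d) Set.countable_empty
      (fun z hz => (hdiff z (by simpa using hz.1)
        (by simpa using hz.2)).continuousAt.continuousWithinAt)
      (fun z hz => hdiff z (by simpa using (Metric.mem_ball.1 hz.1.1).le)
        (by simpa using (not_le.1 (mt Metric.mem_closedBall.2 hz.1.2)).le))
    have h1 : Real.circleAverage (askeyWilsonAux q a b c d) 0 1 =
        Real.circleAverage (askeyWilsonAux q a b c d) 0 ‖q‖ := by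
      rw [Real.circleAverage_eq_circleIntegral one_ne_zero,
        Real.circleAverage_eq_circleIntegral hq'.ne', h]
    have h2 : Real.circleAverage (fun z => askeyWilsonAux q a b c d (q * z)) 0 1 =
        -Real.circleAverage (fun z => askeyWilsonAux q a b c d z⁻¹) 0 1 := by
      rw [← neg_one_smul ℝ, ← Real.circleAverage_smul]
      refine Real.circleAverage_congr_sphere fun z hz => ?_
      have hz0 : z ≠ 0 := by
        rintro rfl
        simp at hz
      simpa using askeyWilsonAux_shift hq hq0 a b c d hz0
    rw [Real.circleAverage_norm_radius, h2, Real.circleAverage_zero_one_congr_inv] at h1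
    exact self_eq_neg.1 h1

theorem askeyWilsonAux_add_inv {q a b c d : ℂ} (hq : ‖q‖ < 1) (ha : ‖a‖ < 1)
    (hb : ‖b‖ < 1) (hc : ‖c‖ < 1) (hd : ‖d‖ < 1) {z : ℂ} (hz : ‖z‖ = 1) :
    askeyWilsonAux q a b c d z + askeyWilsonAux q a b c d z⁻¹ =
      askeyWilsonWeight q a b c d z * ((1 - a * b * c * d) * (z + z⁻¹) -
        (a + b + c + d - (b * c * d + a * c * d + a * b * d + a * b * c))) := by
  have hz0 : z ≠ 0 := by
    rintro rfl
    simp at hz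
  have hz' : ‖z⁻¹‖ = 1 := by simp [hz]
  have key (x w : ℂ) (hx : ‖x‖ < 1) (hw : ‖w‖ = 1) :
      (qPochInf (x * w) q)⁻¹ = (qPochInf (x * q * w) q)⁻¹ * (1 - x * w)⁻¹ := by
    rw [qPochInf_step _ hq, mul_inv_rev]
    congr 3
    ring
  have key2 (w : ℂ) : qPochInf (w ^ 2) q = (1 - w ^ 2) * qPochInf (q * w ^ 2) q := by
    rw [qPochInf_step _ hq, mul_comm q]
  have hne (x w : ℂ) (hx : ‖x‖ < 1) (hw : ‖w‖ = 1) : 1 - x * w ≠ 0 :=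
    one_sub_ne_zero_of_norm_lt_one (by rw [norm_mul, hw, mul_one]; exact hx)
  have ha1 := hne a z ha hz
  have hb1 := hne b z hb hz
  have hc1 := hne c z hc hz
  have hd1 := hne d z hd hz
  have ha2 := hne a z⁻¹ ha hz'
  have hb2 := hne b z⁻¹ hb hz'
  have hc2 := hne c z⁻¹ hc hz'
  have hd2 := hne d z⁻¹ hd hz'
  simp only [askeyWilsonAux, askeyWilsonWeight, qPochSym, inv_inv, div_eq_mul_inv, mul_inv,
    key a z ha hz, key a z⁻¹ ha hz', key b z hb hz, key b z⁻¹ hb hz', key c z hc hz,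
    key c z⁻¹ hc hz', key d z hd hz, key d z⁻¹ hd hz', key2 z, key2 z⁻¹]
  generalize qPochInf (q * z ^ 2) q = u1
  generalize qPochInf (q * z⁻¹ ^ 2) q = u2
  generalize (qPochInf (a * q * z) q)⁻¹ = a1
  generalize (qPochInf (b * q * z) q)⁻¹ = b1
  generalize (qPochInf (c * q * z) q)⁻¹ = c1
  generalize (qPochInf (d * q * z) q)⁻¹ = d1
  generalize (qPochInf (a * q * z⁻¹) q)⁻¹ = a2
  generalize (qPochInf (b * q * z⁻¹) q)⁻¹ = b2
  generalize (qPochInf (c * q * z⁻¹) q)⁻¹ = c2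
  generalize (qPochInf (d * q * z⁻¹) q)⁻¹ = d2
  have hzz : z * z⁻¹ = 1 := mul_inv_cancel₀ hz0
  generalize z⁻¹ = w at *
  -- The algebraic core: after removing the common infinite products, the symmetrized numerator is
  -- divisible by `(1 - z²)(1 - z⁻²)`, with quotient linear in `z + z⁻¹`.
  have hU : (z * ((1 - z ^ 2) * ((1 - a * w) * (1 - b * w) * (1 - c * w) * (1 - d * w))) +
      w * ((1 - w ^ 2) * ((1 - a * z) * (1 - b * z) * (1 - c * z) * (1 - d * z)))) =
      (1 - z ^ 2) * (1 - w ^ 2) * ((1 - a * b * c * d) * (z + w) -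
        (a + b + c + d - (b * c * d + a * c * d + a * b * d + a * b * c))) := by
    obtain rfl : w = z⁻¹ := eq_inv_of_mul_eq_one_right hzz
    field_simp
    ring
  generalize (1 - a * b * c * d) * (z + w) -
    (a + b + c + d - (b * c * d + a * c * d + a * b * d + a * b * c)) = e at *
  clear key key2 hne
  have hX1 : (1 - a * z) * (1 - b * z) * (1 - c * z) * (1 - d * z) *
      ((1 - a * z)⁻¹ * (1 - b * z)⁻¹ * (1 - c * z)⁻¹ * (1 - d * z)⁻¹) = 1 := by
    simp only [← mul_inv]
    exact mul_inv_cancel₀ (mul_ne_zero (mul_ne_zero (mul_ne_zero ha1 hb1) hc1) hd1)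
  have hX2 : (1 - a * w) * (1 - b * w) * (1 - c * w) * (1 - d * w) *
      ((1 - a * w)⁻¹ * (1 - b * w)⁻¹ * (1 - c * w)⁻¹ * (1 - d * w)⁻¹) = 1 := by
    simp only [← mul_inv]
    exact mul_inv_cancel₀ (mul_ne_zero (mul_ne_zero (mul_ne_zero ha2 hb2) hc2) hd2)
  generalize (1 - a * z)⁻¹ = α1 at *
  generalize (1 - b * z)⁻¹ = β1 at *
  generalize (1 - c * z)⁻¹ = γ1 at *
  generalize (1 - d * z)⁻¹ = δ1 at *
  generalize (1 - a * w)⁻¹ = α2 at *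
  generalize (1 - b * w)⁻¹ = β2 at *
  generalize (1 - c * w)⁻¹ = γ2 at *
  generalize (1 - d * w)⁻¹ = δ2 at *
  generalize (1 - a * z) * (1 - b * z) * (1 - c * z) * (1 - d * z) = p1 at *
  generalize (1 - a * w) * (1 - b * w) * (1 - c * w) * (1 - d * w) = p2 at *
  linear_combination u1 * u2 * a1 * a2 * b1 * b2 * c1 * c2 * d1 * d2 *
    (α1 * β1 * γ1 * δ1 * (α2 * β2 * γ2 * δ2) * hU - z * (1 - z ^ 2) * (α1 * β1 * γ1 * δ1) * hX2 -
      w * (1 - w ^ 2) * (α2 * β2 * γ2 * δ2) * hX1)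

/-- The Askey–Wilson integral, as an average over the unit circle. -/
noncomputable def askeyWilsonAverage (q a b c d : ℂ) : ℂ :=
  Real.circleAverage (askeyWilsonWeight q a b c d) 0 1

theorem circleAverage_askeyWilsonWeight_mul {q a b c d : ℂ} (hq : ‖q‖ < 1) (ha : ‖a‖ < 1)
    (hb : ‖b‖ < 1) (hc : ‖c‖ < 1) (hd : ‖d‖ < 1) (u v : ℂ) :
    Real.circleAverage (fun z => askeyWilsonWeight q a b c d z * (u * (z + z⁻¹) - v)) 0 1 =
      u * Real.circleAverage (fun z => askeyWilsonWeight q a b c d z * (z + z⁻¹)) 0 1 -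
        v * askeyWilsonAverage q a b c d := by
  have hW := continuousOn_askeyWilsonWeight hq ha hb hc hd
  have hinv : ContinuousOn (fun z : ℂ => z⁻¹) (Metric.sphere 0 1) :=
    continuousOn_inv₀.mono fun z hz => by
      rintro rfl
      simp at hz
  have h1 : CircleIntegrable (fun z => u • (askeyWilsonWeight q a b c d z * (z + z⁻¹))) 0 1 :=
    ContinuousOn.circleIntegrable zero_le_one (by fun_prop)
  have h2 : CircleIntegrable (fun z => v • askeyWilsonWeight q a b c d z) 0 1 :=
    ContinuousOn.circleIntegrable zero_le_one (by fun_prop)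
  rw [← smul_eq_mul u, ← smul_eq_mul v, askeyWilsonAverage, ← Real.circleAverage_fun_smul,
    ← Real.circleAverage_fun_smul, ← Real.circleAverage_fun_sub h1 h2]
  congr 1
  funext z
  simp only [smul_eq_mul]
  ring

theorem continuousOn_askeyWilsonAux {q a b c d : ℂ} (hq : ‖q‖ < 1) (ha : ‖a‖ < 1)
    (hb : ‖b‖ < 1) (hc : ‖c‖ < 1) (hd : ‖d‖ < 1) :
    ContinuousOn (askeyWilsonAux q a b c d) (Metric.sphere 0 1) := fun z hz => by
  have hz : ‖z‖ = 1 := by simpa using hz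
  exact (differentiableAt_askeyWilsonAux hq ha hb hc hd (norm_ne_zero_iff.1 (by simp [hz]))
    hz.le (hz ▸ hq.le)).continuousAt.continuousWithinAt

/-! ### Evaluation of the Askey–Wilson integral. -/

/-- Two linear relations involve the average of `W·(z + z⁻¹)`: the vanishing one from the contour
shift, and the one from `W(aq) = W(a)(1 - az)(1 - a/z)`. Eliminating that average leaves the claim.
-/
theorem askeyWilsonAverage_step {q a b c d : ℂ} (hq : ‖q‖ < 1) (ha : ‖a‖ < 1)
    (hb : ‖b‖ < 1) (hc : ‖c‖ < 1) (hd : ‖d‖ < 1) :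
    askeyWilsonAverage q a b c d * ((1 - a * b) * (1 - a * c) * (1 - a * d)) =
      (1 - a * b * c * d) * askeyWilsonAverage q (a * q) b c d := by
  have hH := continuousOn_askeyWilsonAux hq ha hb hc hd
  have hsphere : Set.MapsTo (fun z : ℂ => z⁻¹) (Metric.sphere 0 1) (Metric.sphere 0 1) :=
    fun z hz => by simpa using hz
  have hinv : ContinuousOn (fun z : ℂ => z⁻¹) (Metric.sphere 0 1) :=
    continuousOn_inv₀.mono fun z hz => by
      rintro rfl
      simp at hz
  have h0 : Real.circleAverage
      (fun z => askeyWilsonAux q a b c d z + askeyWilsonAux q a b c d z⁻¹) 0 1 = 0 := by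
    rw [Real.circleAverage_fun_add (f₂ := fun z => askeyWilsonAux q a b c d z⁻¹)
      (hH.circleIntegrable zero_le_one) ((hH.comp hinv hsphere).circleIntegrable zero_le_one),
      Real.circleAverage_zero_one_congr_inv, circleAverage_askeyWilsonAux hq ha hb hc hd, add_zero]
  rw [Real.circleAverage_congr_sphere (f₂ := fun z => askeyWilsonWeight q a b c d z *
    ((1 - a * b * c * d) * (z + z⁻¹) -
      (a + b + c + d - (b * c * d + a * c * d + a * b * d + a * b * c))))
    (fun z hz => askeyWilsonAux_add_inv hq ha hb hc hd (by simpa using hz)),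
    circleAverage_askeyWilsonWeight_mul hq ha hb hc hd] at h0
  have h1 : askeyWilsonAverage q (a * q) b c d =
      Real.circleAverage (fun z => askeyWilsonWeight q a b c d z *
        (-a * (z + z⁻¹) - -(1 + a ^ 2))) 0 1 := by
    refine Real.circleAverage_congr_sphere fun z hz => ?_
    have hz : ‖z‖ = 1 := by simpa using hz
    have hz' : ‖z⁻¹‖ = 1 := by simp [hz]
    have hzz : z * z⁻¹ = 1 := mul_inv_cancel₀ (norm_ne_zero_iff.1 (by simp [hz]))
    have hne (w : ℂ) (hw : ‖w‖ = 1) : 1 - a * w ≠ 0 :=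
      one_sub_ne_zero_of_norm_lt_one (by rw [norm_mul, hw, mul_one]; exact ha)
    have hs : qPochSym q a z = (1 - a * z) * (1 - a * z⁻¹) * qPochSym q (a * q) z := by
      rw [qPochSym, qPochInf_step _ hq, qPochInf_step (a * z⁻¹) hq, qPochSym,
        mul_right_comm a z q, mul_right_comm a z⁻¹ q]
      ring
    have he : -a * (z + z⁻¹) - -(1 + a ^ 2) = (1 - a * z) * (1 - a * z⁻¹) := by
      linear_combination (-a ^ 2) * hzz
    simp only [askeyWilsonWeight, hs, he]
    have e1 := hne z hz
    have e2 := hne z⁻¹ hz'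
    generalize 1 - a * z = y1 at *
    generalize 1 - a * z⁻¹ = y2 at *
    generalize qPochSym q (a * q) z = u
    field_simp
  rw [circleAverage_askeyWilsonWeight_mul hq ha hb hc hd] at h1
  rw [h1]
  linear_combination a * h0

theorem tendsto_askeyWilsonAverage {q a b c d : ℂ} (hq : ‖q‖ < 1) (ha : ‖a‖ < 1)
    (hb : ‖b‖ < 1) (hc : ‖c‖ < 1) (hd : ‖d‖ < 1) :
    Tendsto (fun N : ℕ => askeyWilsonAverage q (a * q ^ N) b c d) atTop
      (𝓝 (askeyWilsonAverage q 0 b c d)) := by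
  have hcont : Continuous fun x : Metric.ball (0 : ℂ) 1 => askeyWilsonAverage q x b c d := by
    unfold askeyWilsonAverage Real.circleAverage
    refine (intervalIntegral.continuous_parametric_intervalIntegral_of_continuous'
      (f := fun (x : Metric.ball (0 : ℂ) 1) (θ : ℝ) =>
        askeyWilsonWeight q x b c d (circleMap 0 1 θ)) ?_ _ _).const_smul _
    have hP := continuous_qPochInf hq
    have hz0 (θ : ℝ) : circleMap 0 1 θ ≠ 0 := circleMap_ne_center one_ne_zero
    have hz1 (θ : ℝ) : ‖circleMap 0 1 θ‖ = 1 := by simp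
    have hc1 : Continuous fun p : Metric.ball (0 : ℂ) 1 × ℝ => circleMap 0 1 p.2 :=
      (continuous_circleMap 0 1).comp continuous_snd
    have hc2 : Continuous fun p : Metric.ball (0 : ℂ) 1 × ℝ => (circleMap 0 1 p.2)⁻¹ :=
      hc1.inv₀ fun p => hz0 p.2
    have hs (f : Metric.ball (0 : ℂ) 1 × ℝ → ℂ) (hf : Continuous f) :
        Continuous fun p => qPochSym q (f p) (circleMap 0 1 p.2) :=
      (hP.comp (hf.mul hc1)).mul (hP.comp (hf.mul hc2))
    refine Continuous.div (((hP.comp (hc1.pow 2)).mul (hP.comp (hc2.pow 2)))) ?_ fun p => ?_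
    · exact (((hs _ (continuous_subtype_val.comp continuous_fst)).mul (hs _ continuous_const)).mul
        (hs _ continuous_const)).mul (hs _ continuous_const)
    · exact mul_ne_zero (mul_ne_zero (mul_ne_zero
        (qPochSym_ne_zero hq (mem_ball_zero_iff.1 p.1.2) (hz1 _))
        (qPochSym_ne_zero hq hb (hz1 _))) (qPochSym_ne_zero hq hc (hz1 _)))
        (qPochSym_ne_zero hq hd (hz1 _))
  have hlim : Tendsto (fun N : ℕ => (⟨a * q ^ N, by simpa using norm_mul_pow_lt_one hq ha N⟩ :
      Metric.ball (0 : ℂ) 1)) atTop (𝓝 ⟨0, by simp⟩) := by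
    rw [tendsto_subtype_rng]
    simpa using (tendsto_pow_atTop_nhds_zero_of_norm_lt_one hq).const_mul a
  have := (hcont.tendsto ⟨0, by simp⟩).comp hlim
  simpa only [Function.comp_def] using this

theorem askeyWilsonAverage_eq_zero_param {q a b c d : ℂ} (hq : ‖q‖ < 1) (ha : ‖a‖ < 1)
    (hb : ‖b‖ < 1) (hc : ‖c‖ < 1) (hd : ‖d‖ < 1) :
    askeyWilsonAverage q a b c d *
        (qPochInf (a * b) q * qPochInf (a * c) q * qPochInf (a * d) q) =
      qPochInf (a * b * c * d) q * askeyWilsonAverage q 0 b c d := by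
  have hN (N : ℕ) : askeyWilsonAverage q a b c d *
        (qPoch (a * b) q N * qPoch (a * c) q N * qPoch (a * d) q N) =
      qPoch (a * b * c * d) q N * askeyWilsonAverage q (a * q ^ N) b c d := by
    induction N with
    | zero => simp
    | succ N ih =>
      have hst := askeyWilsonAverage_step hq (norm_mul_pow_lt_one hq ha N) hb hc hd
      rw [mul_assoc a (q ^ N) q, ← pow_succ] at hst
      simp only [qPoch_succ]
      linear_combination (1 - a * b * q ^ N) * (1 - a * c * q ^ N) * (1 - a * d * q ^ N) * ih +
        qPoch (a * b * c * d) q N * hst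
  have hl := (((tendsto_qPoch (a * b) hq).mul (tendsto_qPoch (a * c) hq)).mul
    (tendsto_qPoch (a * d) hq)).const_mul (askeyWilsonAverage q a b c d)
  have hr := (tendsto_qPoch (a * b * c * d) hq).mul (tendsto_askeyWilsonAverage hq ha hb hc hd)
  exact tendsto_nhds_unique hl (hr.congr fun N => (hN N).symm)

theorem askeyWilsonAverage_rotate (q a b c d : ℂ) :
    askeyWilsonAverage q a b c d = askeyWilsonAverage q b c d a := by
  simp only [askeyWilsonAverage, funext fun z => show askeyWilsonWeight q a b c d z =
    askeyWilsonWeight q b c d a z by simp only [askeyWilsonWeight]; ring]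

/-- The parameters are sent to `0` one at a time, rotating each new zero to the end so that the next
parameter comes first. -/
theorem askeyWilsonAverage_eq_zero_params {q a b c d : ℂ} (hq : ‖q‖ < 1) (ha : ‖a‖ < 1)
    (hb : ‖b‖ < 1) (hc : ‖c‖ < 1) (hd : ‖d‖ < 1) :
    askeyWilsonAverage q a b c d *
        (qPochInf (a * b) q * qPochInf (a * c) q * qPochInf (a * d) q * qPochInf (b * c) q *
          qPochInf (b * d) q * qPochInf (c * d) q) =
      qPochInf (a * b * c * d) q * askeyWilsonAverage q 0 0 0 0 := by
  have h0 : ‖(0 : ℂ)‖ < 1 := by simp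
  have h1 := askeyWilsonAverage_eq_zero_param hq ha hb hc hd
  have h2 := askeyWilsonAverage_eq_zero_param hq hb hc hd h0
  have h3 := askeyWilsonAverage_eq_zero_param hq hc hd h0 h0
  have h4 := askeyWilsonAverage_eq_zero_param hq hd h0 h0 h0
  simp only [mul_zero, qPochInf_zero_left, mul_one, one_mul] at h2 h3 h4
  rw [askeyWilsonAverage_rotate q 0 b c d] at h1
  rw [askeyWilsonAverage_rotate q 0 c d 0] at h2
  rw [askeyWilsonAverage_rotate q 0 d 0 0] at h3
  rw [h4] at h3
  linear_combination qPochInf (b * c) q * qPochInf (b * d) q * qPochInf (c * d) q * h1 +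
    qPochInf (a * b * c * d) q * (qPochInf (c * d) q * h2 + h3)

/-- Among the first `2N` factors, those of even index split as `(1 - s q^k w)(1 + s q^k w)` and
those of odd index as `(1 - q^(k+1) w)(1 + q^(k+1) w)`. -/
theorem qPochInf_mul_sq {q s : ℂ} (hq : ‖q‖ < 1) (hs : s ^ 2 = q) (w : ℂ) :
    qPochInf (q * w ^ 2) q = qPochInf (s * w) q * qPochInf (-s * w) q *
      (qPochInf (q * w) q * qPochInf (-q * w) q) := by
  have hN (N : ℕ) : qPoch (q * w ^ 2) q (2 * N) = qPoch (s * w) q N * qPoch (-s * w) q N *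
      (qPoch (q * w) q N * qPoch (-q * w) q N) := by
    induction N with
    | zero => simp
    | succ N ih =>
      rw [mul_add, mul_one, qPoch_succ, qPoch_succ, ih]
      simp only [qPoch_succ]
      generalize qPoch (s * w) q N = u1
      generalize qPoch (-s * w) q N = u2
      generalize qPoch (q * w) q N = u3
      generalize qPoch (-q * w) q N = u4
      rw [pow_succ q (2 * N), pow_mul', sq (q ^ N)]
      generalize q ^ N = x
      subst hs
      ring
  have hl := (tendsto_qPoch (q * w ^ 2) hq).comp
    (tendsto_id.const_mul_atTop' (show 0 < 2 by norm_num))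
  have hr := ((tendsto_qPoch (s * w) hq).mul (tendsto_qPoch (-s * w) hq)).mul
    ((tendsto_qPoch (q * w) hq).mul (tendsto_qPoch (-q * w) hq))
  exact tendsto_nhds_unique hl (hr.congr fun N => (hN N).symm)

theorem circleAverage_one_sub_sq_mul :
    Real.circleAverage (fun z : ℂ => (1 - z ^ 2) * (1 - z⁻¹ ^ 2)) 0 1 = 2 := by
  have hd : Differentiable ℂ fun z : ℂ => 1 - z ^ 2 := by fun_prop
  have h1 : Real.circleAverage (fun z : ℂ => 1 - z ^ 2) 0 1 = 1 := by
    rw [circleAverage_of_differentiable_on_off_countable Set.countable_empty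
      hd.continuous.continuousOn fun z _ => hd z]
    simp
  have h2 : Real.circleAverage (fun z : ℂ => 1 - z⁻¹ ^ 2) 0 1 = 1 := by
    rw [Real.circleAverage_zero_one_congr_inv (f := fun z : ℂ => 1 - z ^ 2), h1]
  have hinv : ContinuousOn (fun z : ℂ => z⁻¹) (Metric.sphere 0 1) :=
    continuousOn_inv₀.mono fun z hz => by
      rintro rfl
      simp at hz
  have i1 : CircleIntegrable (fun z : ℂ => 1 - z ^ 2) 0 1 :=
    ContinuousOn.circleIntegrable zero_le_one (by fun_prop)
  have i2 : CircleIntegrable (fun z : ℂ => 1 - z⁻¹ ^ 2) 0 1 :=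
    ContinuousOn.circleIntegrable zero_le_one (by fun_prop)
  have h3 := Real.circleAverage_fun_add i1 i2
  rw [h1, h2, one_add_one_eq_two] at h3
  rw [← h3]
  refine Real.circleAverage_congr_sphere fun z hz => ?_
  have hzz : z * z⁻¹ = 1 := mul_inv_cancel₀ (by rintro rfl; simp at hz)
  linear_combination (z * z⁻¹ + 1) * hzz

/-- For the parameters `s, -s, q, -q` with `s² = q`, the duplication formula collapses the weight to
`(1 - z²)(1 - z⁻²)`, of average `2`; comparison with the general reduction gives the constant. -/
theorem askeyWilsonAverage_zero {q : ℂ} (hq : ‖q‖ < 1) :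
    askeyWilsonAverage q 0 0 0 0 * qPochInf q q = 2 := by
  obtain ⟨s, hs⟩ := IsAlgClosed.exists_pow_nat_eq q (n := 2) two_pos
  have hs1 : ‖s‖ < 1 := by
    rw [← hs, norm_pow] at hq
    exact (sq_lt_one_iff₀ (norm_nonneg _)).1 hq
  have hav : askeyWilsonAverage q s (-s) q (-q) = 2 := by
    rw [← circleAverage_one_sub_sq_mul]
    refine Real.circleAverage_congr_sphere fun z hz => ?_
    have hz : ‖z‖ = 1 := by simpa using hz
    have hz' : ‖z⁻¹‖ = 1 := by simp [hz]
    have hne (w : ℂ) (hw : ‖w‖ = 1) : qPochInf (q * w ^ 2) q ≠ 0 :=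
      qPochInf_ne_zero hq (by simpa [hw] using hq)
    have hst (w : ℂ) : qPochInf (w ^ 2) q = (1 - w ^ 2) * qPochInf (q * w ^ 2) q := by
      rw [qPochInf_step _ hq, mul_comm q]
    have hden : qPochSym q s z * qPochSym q (-s) z * qPochSym q q z * qPochSym q (-q) z =
        qPochInf (q * z ^ 2) q * qPochInf (q * z⁻¹ ^ 2) q := by
      rw [qPochInf_mul_sq hq hs z, qPochInf_mul_sq hq hs z⁻¹]
      simp only [qPochSym]
      ring
    rw [askeyWilsonWeight, hden, hst z, hst z⁻¹, div_eq_iff (mul_ne_zero (hne z hz) (hne _ hz'))]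
    ring
  have h := askeyWilsonAverage_eq_zero_params hq hs1 (by simpa using hs1 : ‖-s‖ < 1) hq
    (by simpa using hq : ‖-q‖ < 1)
  rw [hav, show s * -s = -q by rw [← hs]; ring, show -q * q * -q = q * q ^ 2 by ring, show s * -q = -s * q by ring, show -s * -q = s * q by ring,
    show q * -q = -q * q by ring, qPochInf_mul_sq hq hs q] at h
  have h1 := qPochInf_mul_sq hq hs 1
  simp only [one_pow, mul_one] at h1
  rw [qPochInf_step s hq, qPochInf_step (-s) hq] at h1
  have hQ := qPochInf_ne_zero hq hq
  have hQ2 := qPochInf_step q hq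
  -- Duplication at `w = 1` reads `(q; q)_∞ = (s, -s, q, -q; q)_∞`; cancel `(q; q)_∞` and use `(1 -
  -- s)(1 + s) = 1 - q`.
  have h2 : (1 - q) * (qPochInf (s * q) q * qPochInf (-s * q) q) * qPochInf (-q) q = 1 := by
    apply mul_right_cancel₀ hQ
    rw [one_mul]
    conv_rhs => rw [h1]
    rw [← hs]
    ring
  have hsq : ‖s * q‖ < 1 := norm_mul_lt_one hs1 hq
  have n1 := qPochInf_ne_zero hq hsq
  have n2 : qPochInf (-s * q) q ≠ 0 := qPochInf_ne_zero hq (by simpa using hsq)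
  have n3 : qPochInf (-q * q) q ≠ 0 := qPochInf_ne_zero hq (by simpa using norm_mul_lt_one hq hq)
  apply mul_left_cancel₀ (mul_ne_zero (mul_ne_zero n1 n2) n3)
  rw [hQ2]
  linear_combination (-(1 - q)) * h +
    2 * qPochInf (s * q) q * qPochInf (-s * q) q * qPochInf (-q * q) q * h2

/-- The Askey–Wilson integral. -/
theorem askeyWilsonAverage_eq {q a b c d : ℂ} (hq : ‖q‖ < 1) (ha : ‖a‖ < 1)
    (hb : ‖b‖ < 1) (hc : ‖c‖ < 1) (hd : ‖d‖ < 1) :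
    askeyWilsonAverage q a b c d = 2 * qPochInf (a * b * c * d) q /
      (qPochInf q q * (qPochInf (a * b) q * qPochInf (a * c) q * qPochInf (a * d) q *
        qPochInf (b * c) q * qPochInf (b * d) q * qPochInf (c * d) q)) := by
  have hne {x y : ℂ} (hx : ‖x‖ < 1) (hy : ‖y‖ < 1) : qPochInf (x * y) q ≠ 0 :=
    qPochInf_ne_zero hq (norm_mul_lt_one hx hy)
  rw [eq_div_iff (mul_ne_zero (qPochInf_ne_zero hq hq) (mul_ne_zero (mul_ne_zero (mul_ne_zero
    (mul_ne_zero (mul_ne_zero (hne ha hb) (hne ha hc)) (hne ha hd)) (hne hb hc)) (hne hb hd))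
    (hne hc hd)))]
  linear_combination qPochInf q q * askeyWilsonAverage_eq_zero_params hq ha hb hc hd +
    qPochInf (a * b * c * d) q * askeyWilsonAverage_zero hq

/-! ### Passage to the angle, and termwise integration of the series. -/

theorem hProds_div_hProds_eq_askeyWilsonWeight {q : ℂ} (hq : ‖q‖ < 1) (a b c d : ℂ) (θ : ℝ) :
    hProds q (Complex.cos (2 * θ)) [1] / hProds q (Complex.cos θ) [a, b, c, d] =
      askeyWilsonWeight q a b c d (Complex.exp (Complex.I * θ)) := by
  have h1 : Complex.exp (Complex.I * (2 * θ)) = Complex.exp (Complex.I * θ) ^ 2 := by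
    rw [← Complex.exp_nat_mul]
    congr 1
    push_cast
    ring
  have h2 : hProd q (Complex.cos (2 * θ)) 1 = qPochInf (Complex.exp (Complex.I * θ) ^ 2) q *
      qPochInf ((Complex.exp (Complex.I * θ))⁻¹ ^ 2) q := by
    rw [hProd_cos 1 (2 * θ) hq, Complex.exp_neg, h1]
    simp [qPochsInf]
  simp only [hProds, List.map_cons, List.map_nil, List.prod_cons, List.prod_nil, mul_one, h2]
  simp only [hProd_cos _ _ hq, List.map_cons, List.map_nil, List.prod_cons, List.prod_nil, mul_one,
    qPochsInf, askeyWilsonWeight, qPochSym, ← Complex.exp_neg, mul_assoc]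

theorem continuous_askeyWilsonWeight_exp {q a b c d : ℂ} (hq : ‖q‖ < 1) (ha : ‖a‖ < 1)
    (hb : ‖b‖ < 1) (hc : ‖c‖ < 1) (hd : ‖d‖ < 1) :
    Continuous fun θ : ℝ => askeyWilsonWeight q a b c d (Complex.exp (Complex.I * θ)) :=
  (continuousOn_askeyWilsonWeight hq ha hb hc hd).comp_continuous (by fun_prop) fun θ => by
    simp [mul_comm Complex.I, Complex.norm_exp_ofReal_mul_I]

/-- The substitution `θ ↦ 2π - θ` is `z ↦ z⁻¹`, which preserves the weight, so the half circle
carries half of the full integral. -/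
theorem integral_askeyWilsonWeight {q a b c d : ℂ} (hq : ‖q‖ < 1) (ha : ‖a‖ < 1)
    (hb : ‖b‖ < 1) (hc : ‖c‖ < 1) (hd : ‖d‖ < 1) :
    ∫ θ in (0 : ℝ)..Real.pi, askeyWilsonWeight q a b c d (Complex.exp (Complex.I * θ)) =
      Real.pi * askeyWilsonAverage q a b c d := by
  have hcont := continuous_askeyWilsonWeight_exp hq ha hb hc hd
  have h1 : ∫ θ in (Real.pi : ℝ)..2 * Real.pi,
      askeyWilsonWeight q a b c d (Complex.exp (Complex.I * θ)) =
      ∫ θ in (0 : ℝ)..Real.pi, askeyWilsonWeight q a b c d (Complex.exp (Complex.I * θ)) := by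
    have h := intervalIntegral.integral_comp_sub_left (a := 0) (b := Real.pi)
      (fun θ : ℝ => askeyWilsonWeight q a b c d (Complex.exp (Complex.I * θ))) (2 * Real.pi)
    rw [sub_zero, show 2 * Real.pi - Real.pi = Real.pi by ring] at h
    rw [← h]
    congr 1 with θ
    rw [← askeyWilsonWeight_inv, ← Complex.exp_neg]
    congr 1
    rw [Complex.exp_eq_exp_iff_exists_int]
    refine ⟨-1, ?_⟩
    push_cast
    ring
  have h2 := intervalIntegral.integral_add_adjacent_intervals
    (hcont.intervalIntegrable (μ := MeasureTheory.volume) 0 Real.pi)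
    (hcont.intervalIntegrable Real.pi (2 * Real.pi))
  rw [h1] at h2
  have h3 : askeyWilsonAverage q a b c d = (2 * Real.pi)⁻¹ • ∫ θ in (0 : ℝ)..2 * Real.pi,
      askeyWilsonWeight q a b c d (Complex.exp (Complex.I * θ)) := by
    rw [askeyWilsonAverage, Real.circleAverage_def]
    congr 2 with θ
    rw [circleMap_zero, Complex.ofReal_one, one_mul, mul_comm Complex.I]
  rw [h3, ← h2, Complex.real_smul]
  have := Complex.ofReal_ne_zero.2 Real.pi_ne_zero
  push_cast
  field_simp
  ring

theorem basicHypergeomTerm_three_two (x y w u v q z : ℂ) (n : ℕ) :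
    basicHypergeomTerm [x, y, w] [u, v] q z n =
      qPoch x q n * qPoch y q n * qPoch w q n *
        ((qPoch q q n)⁻¹ * (qPoch u q n)⁻¹ * (qPoch v q n)⁻¹) * z ^ n := by
  simp only [basicHypergeomTerm, qPochs, List.map_cons, List.map_nil, List.prod_cons,
    List.prod_nil, List.length_cons, List.length_nil, div_eq_mul_inv, mul_inv, mul_one]
  norm_num
  left
  ring

theorem norm_basicHypergeomTerm_three_two_le {q : ℂ} (hq : ‖q‖ < 1) {ρ σ : ℝ} (hσ : σ < 1)
    {x y w u v : ℂ} (hx : ‖x‖ ≤ ρ) (hy : ‖y‖ ≤ ρ) (hw : ‖w‖ ≤ ρ) (hu : ‖u‖ ≤ σ) (hv : ‖v‖ ≤ σ)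
    (z : ℂ) (n : ℕ) :
    ‖basicHypergeomTerm [x, y, w] [u, v] q z n‖ ≤
      Real.exp (ρ / (1 - ‖q‖)) * Real.exp (ρ / (1 - ‖q‖)) * Real.exp (ρ / (1 - ‖q‖)) *
        (Real.exp (‖q‖ / (1 - ‖q‖) / (1 - ‖q‖)) * Real.exp (σ / (1 - σ) / (1 - ‖q‖)) *
          Real.exp (σ / (1 - σ) / (1 - ‖q‖))) * ‖z‖ ^ n := by
  rw [basicHypergeomTerm_three_two]
  simp only [norm_mul, norm_pow]
  gcongr
  · exact norm_qPoch_le hq hx n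
  · exact norm_qPoch_le hq hy n
  · exact norm_qPoch_le hq hw n
  · simpa only [norm_inv] using norm_qPoch_inv_le hq le_rfl hq n
  · simpa only [norm_inv] using norm_qPoch_inv_le hq hu hσ n
  · simpa only [norm_inv] using norm_qPoch_inv_le hq hv hσ n

theorem qPoch_mul_askeyWilsonWeight {q a b c d z : ℂ} (hq : ‖q‖ < 1) (hc : ‖c‖ < 1)
    (hz : ‖z‖ = 1) (n : ℕ) :
    askeyWilsonWeight q a b c d z * (qPoch (c * z) q n * qPoch (c * z⁻¹) q n) =
      askeyWilsonWeight q a b (c * q ^ n) d z := by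
  have h (w : ℂ) (hw : ‖w‖ = 1) : ‖c * w‖ < 1 := by rwa [norm_mul, hw, mul_one]
  have h1 := qPoch_ne_zero hq (h z hz) n
  have h2 := qPoch_ne_zero hq (h z⁻¹ (by simp [hz])) n
  have hs : qPochSym q c z =
      qPoch (c * z) q n * qPoch (c * z⁻¹) q n * qPochSym q (c * q ^ n) z := by
    rw [qPochSym, qPochInf_eq_mul _ hq n, qPochInf_eq_mul (c * z⁻¹) hq n, qPochSym,
      mul_right_comm c z, mul_right_comm c z⁻¹]
    ring
  simp only [askeyWilsonWeight, hs]
  generalize qPoch (c * z) q n = u at *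
  generalize qPoch (c * z⁻¹) q n = v at *
  field_simp

theorem hasSum_integral_betaIntegrand {q a b c d r : ℂ} (hq : ‖q‖ < 1)
    (ha : ‖a‖ < 1) (hb : ‖b‖ < 1) (hc : ‖c‖ < 1) (hd : ‖d‖ < 1)
    (habrc : ‖a * b * r / c‖ < 1) :
    (∀ θ : ℝ, Summable (basicHypergeomTerm
      [c * Complex.exp (Complex.I * θ), c * Complex.exp (-(Complex.I * θ)), c / r]
      [a * c, b * c] q (a * b * r / c))) ∧
    Continuous (betaIntegrand q a b c d r) ∧
    HasSum (fun n => ∫ θ in (0 : ℝ)..Real.pi,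
      askeyWilsonWeight q a b (c * q ^ n) d (Complex.exp (Complex.I * θ)) *
        (qPoch (c / r) q n * ((qPoch q q n)⁻¹ * (qPoch (a * c) q n)⁻¹ * (qPoch (b * c) q n)⁻¹) *
          (a * b * r / c) ^ n)) (∫ θ in (0 : ℝ)..Real.pi, betaIntegrand q a b c d r θ) := by
  have hexp (θ : ℝ) : ‖Complex.exp (Complex.I * θ)‖ = 1 := by
    rw [mul_comm, Complex.norm_exp_ofReal_mul_I]
  have hexp' (θ : ℝ) : ‖Complex.exp (-(Complex.I * θ))‖ = 1 := by
    rw [Complex.exp_neg, norm_inv, hexp, inv_one]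
  have hbound (n : ℕ) (θ : ℝ) := norm_basicHypergeomTerm_three_two_le hq
    -- `1` bounds `c e^{±iθ}` for every `θ`, so the majorant is independent of the angle.
    (ρ := max 1 ‖c / r‖) (σ := max ‖a * c‖ ‖b * c‖)
    (max_lt (norm_mul_lt_one ha hc) (norm_mul_lt_one hb hc))
    (x := c * Complex.exp (Complex.I * θ)) (y := c * Complex.exp (-(Complex.I * θ)))
    (w := c / r) (le_max_of_le_left (by rw [norm_mul, hexp, mul_one]; exact hc.le))
    (le_max_of_le_left (by rw [norm_mul, hexp', mul_one]; exact hc.le)) (le_max_right _ _)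
    (le_max_left _ _) (le_max_right _ _) (a * b * r / c) n
  set K := Real.exp (max 1 ‖c / r‖ / (1 - ‖q‖)) * Real.exp (max 1 ‖c / r‖ / (1 - ‖q‖)) *
    Real.exp (max 1 ‖c / r‖ / (1 - ‖q‖)) * (Real.exp (‖q‖ / (1 - ‖q‖) / (1 - ‖q‖)) *
      Real.exp (max ‖a * c‖ ‖b * c‖ / (1 - max ‖a * c‖ ‖b * c‖) / (1 - ‖q‖)) *
      Real.exp (max ‖a * c‖ ‖b * c‖ / (1 - max ‖a * c‖ ‖b * c‖) / (1 - ‖q‖)))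
  have hgeom : Summable fun n : ℕ => K * ‖a * b * r / c‖ ^ n :=
    (summable_geometric_of_lt_one (norm_nonneg _) habrc).mul_left K
  have hsum (θ : ℝ) : Summable (basicHypergeomTerm
      [c * Complex.exp (Complex.I * θ), c * Complex.exp (-(Complex.I * θ)), c / r]
      [a * c, b * c] q (a * b * r / c)) := .of_norm_bounded hgeom fun n => hbound n θ
  have hterm (n : ℕ) : Continuous fun θ : ℝ => basicHypergeomTerm
      [c * Complex.exp (Complex.I * θ), c * Complex.exp (-(Complex.I * θ)), c / r]
      [a * c, b * c] q (a * b * r / c) n := by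
    have hd := (differentiable_qPoch q n).continuous
    simp only [basicHypergeomTerm_three_two]
    have h1 : Continuous fun θ : ℝ => qPoch (c * Complex.exp (Complex.I * θ)) q n :=
      hd.comp (by fun_prop)
    have h2 : Continuous fun θ : ℝ => qPoch (c * Complex.exp (-(Complex.I * θ))) q n :=
      hd.comp (by fun_prop)
    fun_prop
  have hW := continuous_askeyWilsonWeight_exp hq ha hb hc hd
  have heq : betaIntegrand q a b c d r = fun θ : ℝ =>
      askeyWilsonWeight q a b c d (Complex.exp (Complex.I * θ)) *
        ∑' n, basicHypergeomTerm
          [c * Complex.exp (Complex.I * θ), c * Complex.exp (-(Complex.I * θ)), c / r]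
          [a * c, b * c] q (a * b * r / c) n := by
    funext θ
    rw [betaIntegrand, hProds_div_hProds_eq_askeyWilsonWeight hq, basicHypergeom]
  refine ⟨hsum, ?_, ?_⟩
  · rw [heq]
    exact hW.mul (continuous_tsum hterm hgeom hbound)
  · obtain ⟨M, hM⟩ := (isCompact_uIcc (a := (0 : ℝ)) (b := Real.pi)).exists_bound_of_continuousOn
      hW.continuousOn
    have hF (n : ℕ) (θ : ℝ) : askeyWilsonWeight q a b (c * q ^ n) d (Complex.exp (Complex.I * θ)) *
        (qPoch (c / r) q n * ((qPoch q q n)⁻¹ * (qPoch (a * c) q n)⁻¹ * (qPoch (b * c) q n)⁻¹) *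
          (a * b * r / c) ^ n) =
        askeyWilsonWeight q a b c d (Complex.exp (Complex.I * θ)) *
          basicHypergeomTerm
            [c * Complex.exp (Complex.I * θ), c * Complex.exp (-(Complex.I * θ)), c / r]
            [a * c, b * c] q (a * b * r / c) n := by
      rw [← qPoch_mul_askeyWilsonWeight hq hc (hexp θ) n, basicHypergeomTerm_three_two,
        ← Complex.exp_neg]
      ring
    simp only [hF]
    refine intervalIntegral.hasSum_integral_of_dominated_convergence
      (fun n _ => M * (K * ‖a * b * r / c‖ ^ n))
      (fun n => (hW.mul (hterm n)).aestronglyMeasurable) (fun n => .of_forall fun θ hθ => ?_)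
      (.of_forall fun _ _ => hgeom.mul_left M) (by simp) (.of_forall fun θ _ => ?_)
    · have hm := hM θ (Set.uIoc_subset_uIcc hθ)
      rw [norm_mul]
      exact mul_le_mul hm (hbound n θ) (norm_nonneg _) ((norm_nonneg _).trans hm)
    · rw [heq]
      exact (hsum θ).hasSum.mul_left _

theorem integral_betaIntegrand {q a b c d r : ℂ} (hq : ‖q‖ < 1) (hc0 : c ≠ 0) (hr0 : r ≠ 0)
    (ha : ‖a‖ < 1) (hb : ‖b‖ < 1) (hc : ‖c‖ < 1) (hd : ‖d‖ < 1)
    (habrc : ‖a * b * r / c‖ < 1) :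
    ∫ θ in (0 : ℝ)..Real.pi, betaIntegrand q a b c d r θ =
      2 * (Real.pi : ℂ) * qPochInf (a * b * d * r) q /
        qPochsInf [q, a * c, a * d, b * c, b * d, c * d, a * b * r / c] q := by
  have hS := (hasSum_integral_betaIntegrand hq ha hb hc hd habrc).2.2
  -- The lower parameter `ABz` of the `q`-Gauss sum with `A = c/r`, `B = cd`, `z = abr/c`.
  have hC : c / r * (c * d) * (a * b * r / c) = a * b * c * d := by field_simp
  have hCn : ‖a * b * c * d‖ < 1 := norm_mul_lt_one (norm_mul_lt_one (norm_mul_lt_one ha hb) hc) hd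
  have hne {x y : ℂ} (hx : ‖x‖ < 1) (hy : ‖y‖ < 1) : qPochInf (x * y) q ≠ 0 :=
    qPochInf_ne_zero hq (norm_mul_lt_one hx hy)
  have nab := hne ha hb
  have nac := hne ha hc
  have nad := hne ha hd
  have nbc := hne hb hc
  have nbd := hne hb hd
  have ncd := hne hc hd
  have nq := qPochInf_ne_zero hq hq
  have nabcd := qPochInf_ne_zero hq hCn
  have nz := qPochInf_ne_zero hq habrc
  have hterm (n : ℕ) : (∫ θ in (0 : ℝ)..Real.pi,
      askeyWilsonWeight q a b (c * q ^ n) d (Complex.exp (Complex.I * θ)) *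
        (qPoch (c / r) q n * ((qPoch q q n)⁻¹ * (qPoch (a * c) q n)⁻¹ * (qPoch (b * c) q n)⁻¹) *
          (a * b * r / c) ^ n)) =
      2 * Real.pi * qPochInf (a * b * c * d) q / (qPochInf q q * (qPochInf (a * b) q *
        qPochInf (a * c) q * qPochInf (a * d) q * qPochInf (b * c) q * qPochInf (b * d) q *
        qPochInf (c * d) q)) * qGaussTerm q (c / r) (c * d) (a * b * r / c) n := by
    have hcn := norm_mul_pow_lt_one hq hc n
    rw [intervalIntegral.integral_mul_const, integral_askeyWilsonWeight hq ha hb hcn hd,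
      askeyWilsonAverage_eq hq ha hb hcn hd, qGaussTerm, hC,
      show a * b * (c * q ^ n) * d = a * b * c * d * q ^ n by ring,
      show a * (c * q ^ n) = a * c * q ^ n by ring, show b * (c * q ^ n) = b * c * q ^ n by ring,
      show c * q ^ n * d = c * d * q ^ n by ring,
      qPochInf_eq_mul (a * b * c * d) hq n, qPochInf_eq_mul (a * c) hq n,
      qPochInf_eq_mul (b * c) hq n, qPochInf_eq_mul (c * d) hq n]
    have m1 := qPoch_ne_zero hq hCn n
    have m2 := qPoch_ne_zero hq (norm_mul_lt_one ha hc) n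
    have m3 := qPoch_ne_zero hq (norm_mul_lt_one hb hc) n
    have m4 := qPoch_ne_zero hq (norm_mul_lt_one hc hd) n
    field_simp
  simp only [hterm] at hS
  rw [← hS.tsum_eq, tsum_mul_left, tsum_qGaussTerm hq habrc (by rwa [hC]), hC,
    show c / r * (a * b * r / c) = a * b by field_simp,
    show c * d * (a * b * r / c) = a * b * d * r by field_simp]
  simp only [qPochsInf, List.map_cons, List.map_nil, List.prod_cons, List.prod_nil, mul_one]
  field_simp

/-! ### The function `I(x)` near `0`. -/

/-- The `q`-binomial theorem, as the case `B = 0` of `q`-Gauss. -/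
theorem basicHypergeom_zero_params {q : ℂ} (hq : ‖q‖ < 1) (x : ℂ) {z : ℂ} (hz : ‖z‖ < 1) :
    basicHypergeom [x, 0, 0] [0, 0] q z = qPochInf (x * z) q / qPochInf z q := by
  have h := tsum_qGaussTerm (A := x) (B := 0) hq hz (by simp)
  simp only [mul_zero, zero_mul, qPochInf_zero_left, mul_one, one_mul] at h
  rw [← h, basicHypergeom]
  refine tsum_congr fun n => ?_
  simp only [basicHypergeomTerm_three_two, qGaussTerm, mul_zero, zero_mul, qPoch_zero_left,
    inv_one, mul_one]

theorem analyticAt_liuI {q a b c d : ℂ} (hq : ‖q‖ < 1) (ha : ‖a‖ < 1) (hb : ‖b‖ < 1)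
    (hc : ‖c‖ < 1) (hd : ‖d‖ < 1) (r : ℂ) : AnalyticAt ℂ (liuI q a b c d r) 0 := by
  -- `r` may be large, so the radius is chosen to give both `|x| ≤ 1/2` and `|abrx| ≤ 1/2`, keeping
  -- all denominators away from `0`.
  set δ : ℝ := 1 / (2 * (1 + ‖a * b * r‖)) with hδ
  have hδ0 : 0 < δ := by positivity
  have hδ1 : δ ≤ 1 / 2 := by
    rw [hδ]
    gcongr
    have := norm_nonneg (a * b * r)
    linarith
  have hδr : ‖a * b * r‖ * δ ≤ 1 / 2 := by
    rw [hδ, mul_one_div, div_le_div_iff₀ (by positivity) (by positivity)]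
    linarith
  have hP := differentiable_qPochInf hq
  have hPf (y : ℂ) : Differentiable ℂ fun x => qPochInf (y * x) q := hP.comp (by fun_prop)
  have hpf (n : ℕ) (y : ℂ) : Differentiable ℂ fun x => qPoch (y * x) q n :=
    (differentiable_qPoch q n).comp (by fun_prop)
  have hle {y x : ℂ} (hy : ‖y‖ < 1) (hx : x ∈ Metric.ball (0 : ℂ) δ) : ‖y * x‖ ≤ 1 / 2 := by
    rw [norm_mul]
    exact (mul_le_of_le_one_left (norm_nonneg _) hy.le).trans
      ((mem_ball_zero_iff.1 hx).le.trans hδ1)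
  have hler {x : ℂ} (hx : x ∈ Metric.ball (0 : ℂ) δ) : ‖a * b * r * x‖ ≤ 1 / 2 := by
    rw [norm_mul]
    exact le_trans (by gcongr; exact (mem_ball_zero_iff.1 hx).le) hδr
  have hacd : ‖a * c * d‖ < 1 := norm_mul_lt_one (norm_mul_lt_one ha hc) hd
  have hbd : ‖b * d‖ < 1 := norm_mul_lt_one hb hd
  have hhalf {y : ℂ} (hy : ‖y‖ ≤ 1 / 2) : ‖y‖ < 1 := hy.trans_lt (by norm_num)
  have hdiff : DifferentiableOn ℂ (liuI q a b c d r) (Metric.ball 0 δ) := by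
    refine DifferentiableOn.mul ?_ ?_
    · simp only [qPochsInf, List.map_cons, List.map_nil, List.prod_cons, List.prod_nil, mul_one]
      refine DifferentiableOn.div ((hPf _).mul (hPf _)).differentiableOn
        ((hPf _).mul ((hPf _).mul ((hPf _).mul (hPf _)))).differentiableOn fun x hx => ?_
      have hn {y : ℂ} (hy : ‖y‖ < 1) : qPochInf (y * x) q ≠ 0 :=
        qPochInf_ne_zero hq (hhalf (hle hy hx))
      exact mul_ne_zero (hn ha) (mul_ne_zero (hn hb) (mul_ne_zero (hn hc) (hn hd)))
    · refine Complex.differentiableOn_tsum_of_summable_norm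
        ((summable_geometric_of_lt_one (norm_nonneg _) hbd).mul_left _) (fun n => ?_)
        Metric.isOpen_ball fun n x hx => norm_basicHypergeomTerm_three_two_le hq
          (ρ := max ‖a * r‖ (1 / 2)) (σ := 1 / 2) (by norm_num) (le_max_left _ _)
          (le_max_of_le_right (hle ha hx)) (le_max_of_le_right (hle hc hx)) (hle hacd hx)
          (hler hx) (b * d) n
      simp only [basicHypergeomTerm_three_two]
      have h1 : DifferentiableOn ℂ (fun x => (qPoch (a * c * d * x) q n)⁻¹) (Metric.ball 0 δ) :=
        (hpf n _).differentiableOn.inv fun x hx => qPoch_ne_zero hq (hhalf (hle hacd hx)) n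
      have h2 : DifferentiableOn ℂ (fun x => (qPoch (a * b * r * x) q n)⁻¹) (Metric.ball 0 δ) :=
        (hpf n _).differentiableOn.inv fun x hx => qPoch_ne_zero hq (hhalf (hler hx)) n
      have h3 := (hpf n a).differentiableOn (s := Metric.ball 0 δ)
      have h4 := (hpf n c).differentiableOn (s := Metric.ball 0 δ)
      fun_prop
  exact hdiff.analyticAt (Metric.ball_mem_nhds 0 hδ0)

theorem liuI_zero {q b d : ℂ} (hq : ‖q‖ < 1) (hb : ‖b‖ < 1) (hd : ‖d‖ < 1) (a c r : ℂ) :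
    liuI q a b c d r 0 = qPochInf (a * b * d * r) q / qPochInf (b * d) q := by
  simp only [liuI, mul_zero, qPochsInf, List.map_cons, List.map_nil, List.prod_cons,
    List.prod_nil, mul_one, qPochInf_zero_left, div_one, one_mul]
  rw [basicHypergeom_zero_params hq _ (norm_mul_lt_one hb hd),
    show a * r * (b * d) = a * b * d * r by ring]

theorem mainTheorem3 (q a b c d r : ℂ) (hq : ‖q‖ < 1) (hc0 : c ≠ 0) (hr0 : r ≠ 0)
    (ha : ‖a‖ < 1) (hb : ‖b‖ < 1) (hc : ‖c‖ < 1) (hd : ‖d‖ < 1)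
    (habrc : ‖a * b * r / c‖ < 1) :
    -- the series in the integrand converges and the integrand is integrable
    (∀ θ : ℝ, Summable (basicHypergeomTerm
      [c * Complex.exp (Complex.I * θ), c * Complex.exp (-(Complex.I * θ)), c / r]
      [a * c, b * c] q (a * b * r / c))) ∧
    IntervalIntegrable (betaIntegrand q a b c d r) MeasureTheory.volume 0 Real.pi ∧
    -- the value of the integral
    (∫ θ in (0 : ℝ)..Real.pi, betaIntegrand q a b c d r θ) =
      2 * (Real.pi : ℂ) * qPochInf (a * b * d * r) q /
        qPochsInf [q, a * c, a * d, b * c, b * d, c * d, a * b * r / c] q ∧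
    -- the same value through the constant term of the expansion of `I` about `0`
    ∃ α : ℕ → ℂ,
      (∀ᶠ x in 𝓝 (0 : ℂ), HasSum (fun k : ℕ => α k * x ^ k) (liuI q a b c d r x)) ∧
      (∫ θ in (0 : ℝ)..Real.pi, betaIntegrand q a b c d r θ) =
        2 * (Real.pi : ℂ) * α 0 /
          qPochsInf [q, a * c, a * d, b * c, c * d, a * b * r / c] q := by
  obtain ⟨hsum, hcont, -⟩ := hasSum_integral_betaIntegrand (r := r) hq ha hb hc hd habrc
  have hint := integral_betaIntegrand hq hc0 hr0 ha hb hc hd habrc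
  obtain ⟨p, hp⟩ := analyticAt_liuI hq ha hb hc hd r
  refine ⟨hsum, hcont.intervalIntegrable _ _, hint, p.coeff, ?_, ?_⟩
  · filter_upwards [hp.eventually_hasSum] with x hx
    simpa [mul_comm] using hx
  · have h0 : p.coeff 0 = liuI q a b c d r 0 := hp.coeff_zero _
    rw [hint, h0, liuI_zero hq hb hd]
    simp only [qPochsInf, List.map_cons, List.map_nil, List.prod_cons, List.prod_nil, mul_one]
    have := qPochInf_ne_zero hq (norm_mul_lt_one hb hd)
    field_simp
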